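/- A rectangle is a nondegenerate closed rectangle in the plane with sides parallel to the coordinate axes. A point set $P\subset\mathbb R^2$ pierces all translates of the members of a family $\mathcal F$ if $P\cap(x+S)\neq\emptyset$ for all $S\in\mathcal F$ and all $x\in\mathbb R^2$. Its lower and upper densities $\underline\delta(P)$, $\overline\delta(P)$ are the $\liminf$ and the $\limsup$, as $r\to\infty$, of $|P\cap D_r|/\operatorname{Area}(D_r)$, where $D_r$ is the disk of radius $r$ centered at the origin; if they agree, the common value is the density of $P$. The piercing density $\pi(\mathcal F)$ is the infimum of $\underline\delta(P)$ over all $P$ that pierce all translates of the members of $\mathcal F$. Let $\varphi=\frac12(1+\sqrt5)$ and let $\Lambda_\varphi$ be the lattice with basis $(1,\varphi),(\varphi,-1)$. Theorem. There is an algorithm for the real RAM (exact arithmetic operations $+,-,\cdot,/,\sqrt{\phantom{x}}$ and comparisons of real numbers, integer constants, and indirect addressing, at unit cost) which, given a family $\mathcal F=\{R_1,\dots,R_n\}$ of $n\ge1$ rectangles, computes in $O(n)$ time a basis of a lattice $\Lambda=s\cdot\Lambda_\varphi$ with $s>0$, and its density $\alpha$, such that $\Lambda$ pierces all translates of all members of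 $\mathcal F$ and $$\alpha\le\left(1+\tfrac25\sqrt5\right)\pi(\mathcal F).$$ In particular, since $1+\frac25\sqrt5<1.895$, the number $\alpha$ is a $1.895$-approximation of $\pi(\mathcal F)$: $\pi(\mathcal F)\le\alpha\le1.895\,\pi(\mathcal F)$. -/

import Mathlib

open scoped ENNReal Topology
open Filter MeasureTheory

noncomputable section

namespace Piercing

/-! ### Piercing sets and their density -/

/-- The Euclidean plane. -/
abbrev Plane : Type := EuclideanSpace ℝ (Fin 2)

/-- The translate `x + S` of a shape `S` by the vector `x`. -/
def translate (x : Plane) (S : Set Plane) : Set Plane := (fun s => x + s) '' S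

/-- `P` pierces all translates of all the members of the family `F`. -/
def IsPiercing (F : Set (Set Plane)) (P : Set Plane) : Prop :=
  ∀ S ∈ F, ∀ x : Plane, ∃ p ∈ P, p ∈ translate x S

/-- The disk of radius `r` centred at the origin. -/
def disk (r : ℝ) : Set Plane := Metric.closedBall 0 r

/-- The density `|P ∩ D| / Area(D)` of `P` over the bounded domain `D`; it is `∞` if
`P ∩ D` is infinite. -/
def densityOver (P D : Set Plane) : ℝ≥0∞ := ((P ∩ D).encard : ℝ≥0∞) / volume D

/-- The asymptotic upper density of a point set. -/
def upperDensity (P : Set Plane) : ℝ≥0∞ := limsup (fun r : ℝ => densityOver P (disk r)) atTop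

/-- The asymptotic lower density of a point set. -/
def lowerDensity (P : Set Plane) : ℝ≥0∞ := liminf (fun r : ℝ => densityOver P (disk r)) atTop

/-- The (translative) piercing density: the infimum of the lower densities of all the
point sets that pierce the family. -/
def piercingDensity (F : Set (Set Plane)) : ℝ≥0∞ :=
  ⨅ (P : Set Plane) (_ : IsPiercing F P), lowerDensity P

/-! ### Rectangles and lattices -/

/-- A nondegenerate axis-parallel rectangle `[left, right] × [bottom, top]`. -/
structure Rect where
  left : ℝ
  right : ℝ
  bottom : ℝ
  top : ℝ
  left_lt_right : left < right
  bottom_lt_top : bottom < top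

/-- The set of points of a rectangle (its boundary included). -/
def Rect.toSet (R : Rect) : Set Plane :=
  {p | R.left ≤ p 0 ∧ p 0 ≤ R.right ∧ R.bottom ≤ p 1 ∧ p 1 ≤ R.top}

/-- The family of shapes `{R 0, …, R (n - 1)}`. -/
def family {n : ℕ} (R : Fin n → Rect) : Set (Set Plane) := Set.range fun i => (R i).toSet

/-- The set of all integer combinations of `u` and `v`. -/
def latticeSpan (u v : Plane) : Set Plane :=
  {p | ∃ a b : ℤ, p = (a : ℝ) • u + (b : ℝ) • v}

/-! ### The real RAM

A finite program works on registers for natural numbers (used as counters and addresses),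
registers for real numbers, and a memory of real numbers.  Registers are addressed directly,
memory cells through the content of an index register.  Each instruction costs one step. -/

/-- Instructions of the real RAM.  The first argument is the target, except in jumps. -/
inductive Instr where
  /-- put a natural number into an index register -/
  | iconst (a : ℕ) (c : ℕ)
  /-- sum of two index registers -/
  | iadd (a b c : ℕ)
  /-- truncated difference of two index registers -/
  | isub (a b c : ℕ)
  /-- put an integer into a real register -/
  | rconst (i : ℕ) (z : ℤ)
  /-- sum of two real registers -/
  | radd (i j k : ℕ)
  /-- difference of two real registers -/
  | rsub (i j k : ℕ)
  /-- product of two real registers -/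
  | rmul (i j k : ℕ)
  /-- quotient of two real registers; a fault if the divisor is zero -/
  | rdiv (i j k : ℕ)
  /-- square root of a real register; a fault if its content is negative -/
  | rsqrt (i j : ℕ)
  /-- read into real register `i` the memory cell whose address is in index register `a` -/
  | load (i a : ℕ)
  /-- write real register `i` to the memory cell whose address is in index register `a` -/
  | store (a i : ℕ)
  /-- jump to instruction `l` -/
  | jump (l : ℕ)
  /-- jump to instruction `l` if index register `a` is less than index register `b` -/
  | ijlt (a b l : ℕ)
  /-- jump to instruction `l` if real register `i` is less than real register `j` -/
  | rjlt (i j l : ℕ)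
  /-- stop -/
  | halt

/-- A program is a finite list of instructions. -/
abbrev Program : Type := List Instr

/-- Configurations of the real RAM. -/
structure Config where
  /-- number of the next instruction -/
  pc : ℕ
  /-- index registers -/
  idx : ℕ → ℕ
  /-- real registers -/
  reg : ℕ → ℝ
  /-- memory -/
  mem : ℕ → ℝ

/-- Put `n` into index register `a` and proceed. -/
def Config.setIdx (c : Config) (a n : ℕ) : Config :=
  { c with pc := c.pc + 1, idx := Function.update c.idx a n }

/-- Put `x` into real register `i` and proceed. -/
def Config.setReg (c : Config) (i : ℕ) (x : ℝ) : Config :=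
  { c with pc := c.pc + 1, reg := Function.update c.reg i x }

/-- Put `x` into memory cell `m` and proceed. -/
def Config.setMem (c : Config) (m : ℕ) (x : ℝ) : Config :=
  { c with pc := c.pc + 1, mem := Function.update c.mem m x }

/-- Effect of one instruction; `none` if it stops the machine or is a fault. -/
def Instr.exec (c : Config) : Instr → Option Config
  | .iconst a n => some (c.setIdx a n)
  | .iadd a b d => some (c.setIdx a (c.idx b + c.idx d))
  | .isub a b d => some (c.setIdx a (c.idx b - c.idx d))
  | .rconst i z => some (c.setReg i (z : ℝ))
  | .radd i j k => some (c.setReg i (c.reg j + c.reg k))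
  | .rsub i j k => some (c.setReg i (c.reg j - c.reg k))
  | .rmul i j k => some (c.setReg i (c.reg j * c.reg k))
  | .rdiv i j k => if c.reg k = 0 then none else some (c.setReg i (c.reg j / c.reg k))
  | .rsqrt i j => if c.reg j < 0 then none else some (c.setReg i (Real.sqrt (c.reg j)))
  | .load i a => some (c.setReg i (c.mem (c.idx a)))
  | .store a i => some (c.setMem (c.idx a) (c.reg i))
  | .jump l => some { c with pc := l }
  | .ijlt a b l => some { c with pc := if c.idx a < c.idx b then l else c.pc + 1 }
  | .rjlt i j l => some { c with pc := if c.reg i < c.reg j then l else c.pc + 1 }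
  | .halt => none

/-- One step of a program; a fault if there is no next instruction. -/
def step (prog : Program) (c : Config) : Option Config :=
  (prog[c.pc]?).bind (Instr.exec c)

/-- `Runs prog t c c'`: the program leads from `c` to `c'` in exactly `t` steps. -/
inductive Runs (prog : Program) : ℕ → Config → Config → Prop
  | refl (c : Config) : Runs prog 0 c c
  | cons {t : ℕ} {c d e : Config} (h : step prog c = some d) (hr : Runs prog t d e) :
      Runs prog (t + 1) c e

/-- From `c` the program stops regularly after `t` steps, in the configuration `c'`. -/
def HaltsIn (prog : Program) (t : ℕ) (c c' : Config) : Prop :=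
  Runs prog t c c' ∧ prog[c'.pc]? = some Instr.halt

/-- Memory that holds `n` rectangles: rectangle `k` is stored in the four cells
`4 * k, …, 4 * k + 3`, as `left, right, bottom, top`; all other cells hold `0`. -/
def inputMem {n : ℕ} (R : Fin n → Rect) (m : ℕ) : ℝ :=
  if h : m / 4 < n then
    let Q := R ⟨m / 4, h⟩
    match m % 4 with
    | 0 => Q.left
    | 1 => Q.right
    | 2 => Q.bottom
    | _ => Q.top
  else 0

/-- Initial configuration: index register `0` holds `n`, the memory holds the rectangles,
and all other registers hold `0`. -/
def initConfig {n : ℕ} (R : Fin n → Rect) : Config where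
  pc := 0
  idx := Function.update (fun _ => 0) 0 n
  reg := fun _ => 0
  mem := inputMem R

/-- First output vector: real registers `0` and `1`. -/
def Config.outU (c : Config) : Plane := !₂[c.reg 0, c.reg 1]

/-- Second output vector: real registers `2` and `3`. -/
def Config.outV (c : Config) : Plane := !₂[c.reg 2, c.reg 3]

/-- The output number: real register `4`. -/
def Config.outValue (c : Config) : ℝ := c.reg 4

end Piercing

end

namespace Piercing

/-! If `P` pierces all translates of `R`, the reflected copies `p - R`, `p ∈ P`, cover the plane, so
`P` has lower density at least `1 / area R`. Hence the piercing density is at least `M`, the largest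
inverse area (`le_piercingDensity`).

Conversely, `Λ_φ` is the set of points `(z, φ * z')` with `z ∈ ℤ[φ]` and `z'` its conjugate.
Multiplying `z` by the unit `φ ^ k` shows that `diag(φ ^ k, ψ ^ k)` preserves `Λ_φ`; since `|φ ψ| =
1`, it also preserves area. So rectangles of all aspect ratios reduce to one box, of size `φ × φ ^
2` (`exists_mem_golden_rect`), and every rectangle of area at least `φ ^ 4` meets `Λ_φ`
(`exists_golden_lattice_point`).

Scaling by `s` with `s ^ 2 * φ ^ 4 = 1 / M`, the smallest area, gives a piercing lattice of density
`φ ^ 4 / (φ ^ 2 + 1) * M = (1 + 2 / √5) * M`. The program only needs `M`, one pass over the input.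
-/

/-! ### Area bound for piercing sets -/

theorem Rect.toSet_eq_preimage (R : Rect) :
    R.toSet = WithLp.ofLp ⁻¹' Set.Icc ![R.left, R.bottom] ![R.right, R.top] := by
  ext p
  simp [Rect.toSet, Pi.le_def, Fin.forall_fin_two]
  tauto

theorem Rect.measurableSet (R : Rect) : MeasurableSet R.toSet := by
  rw [R.toSet_eq_preimage]
  exact (PiLp.volume_preserving_ofLp (Fin 2)).measurable measurableSet_Icc

/-- The area of a rectangle. -/
noncomputable def Rect.area (R : Rect) : ℝ := (R.right - R.left) * (R.top - R.bottom)

theorem Rect.area_pos (R : Rect) : 0 < R.area :=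
  mul_pos (sub_pos.2 R.left_lt_right) (sub_pos.2 R.bottom_lt_top)

theorem Rect.volume_toSet (R : Rect) : volume R.toSet = ENNReal.ofReal R.area := by
  rw [R.toSet_eq_preimage, (PiLp.volume_preserving_ofLp (Fin 2)).measure_preimage
    measurableSet_Icc.nullMeasurableSet, Real.volume_Icc_pi, Rect.area,
    ENNReal.ofReal_mul (sub_pos.2 R.left_lt_right).le]
  simp [Fin.prod_univ_two]

theorem Rect.isBounded (R : Rect) : Bornology.IsBounded R.toSet := by
  rw [R.toSet_eq_preimage]
  exact (PiLp.antilipschitzWith_ofLp 2 (fun _ : Fin 2 => ℝ)).isBounded_preimage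
    (Metric.isBounded_Icc _ _)

theorem mem_translate {x p : Plane} {S : Set Plane} : p ∈ translate x S ↔ p - x ∈ S := by
  simp [translate, neg_add_eq_sub]

theorem volume_disk {r : ℝ} (hr : 0 ≤ r) : volume (disk r) = ENNReal.ofReal (r ^ 2 * Real.pi) := by
  rw [disk, EuclideanSpace.volume_closedBall_fin_two, ENNReal.ofReal_mul (by positivity),
    ENNReal.ofReal_pow hr]

/-- A point piercing `x + S` with `x ∈ disk (r - d)` lies in `disk r`, so the reflected copies `p -
S` with `p ∈ P ∩ disk r` cover the smaller disk. `h0` makes the right side infinite when that set is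
infinite. -/
theorem volume_le_encard_mul {P S : Set Plane} (hS : MeasurableSet S) {d r : ℝ}
    (hd : ∀ s ∈ S, ‖s‖ ≤ d) (hP : ∀ x : Plane, ∃ p ∈ P, p ∈ translate x S) (h0 : volume S ≠ 0) :
    volume (disk (r - d)) ≤ ((P ∩ disk r).encard : ℝ≥0∞) * volume S := by
  by_cases hfin : (P ∩ disk r).Finite
  · have hsub : disk (r - d) ⊆ ⋃ p ∈ P ∩ disk r, (fun x => p - x) ⁻¹' S := by
      intro x hx
      obtain ⟨p, hp, hpx⟩ := hP x
      rw [mem_translate] at hpx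
      have h1 := hd _ hpx
      have hx' : ‖x‖ ≤ r - d := by simpa [disk] using hx
      have h2 : ‖p‖ ≤ ‖p - x‖ + ‖x‖ := by simpa using norm_add_le (p - x) x
      refine Set.mem_biUnion (x := p) ⟨hp, ?_⟩ hpx
      simp only [disk, mem_closedBall_zero_iff]
      linarith
    refine (measure_mono hsub).trans ((measure_biUnion_le _ hfin.countable _).trans ?_)
    rw [← ENNReal.tsum_set_const]
    refine ENNReal.tsum_le_tsum fun p => ?_
    rw [(Measure.measurePreserving_sub_left volume (p : Plane)).measure_preimage
      hS.nullMeasurableSet]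
  · rw [Set.encard_eq_top (Set.not_finite.1 hfin)]
    simp [ENNReal.top_mul h0]

theorem tendsto_sub_div_sq (d : ℝ) :
    Tendsto (fun r : ℝ => ((r - d) / r) ^ 2) atTop (𝓝 1) := by
  have h : Tendsto (fun r : ℝ => (1 - d / r) ^ 2) atTop (𝓝 ((1 - 0) ^ 2)) :=
    ((tendsto_const_nhds.sub (tendsto_const_nhds.div_atTop tendsto_id)).pow 2)
  have e : ((1 : ℝ) - 0) ^ 2 = 1 := by norm_num
  rw [e] at h
  refine h.congr' ?_
  filter_upwards [eventually_gt_atTop 0] with r hr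
  rw [sub_div, div_self hr.ne']

/-- A set that pierces all translates of a rectangle has lower density at least the inverse of
its area. -/
theorem le_lowerDensity {P : Set Plane} (R : Rect)
    (hP : ∀ x : Plane, ∃ p ∈ P, p ∈ translate x R.toSet) :
    ENNReal.ofReal (1 / R.area) ≤ lowerDensity P := by
  obtain ⟨d, hd⟩ := R.isBounded.exists_norm_le
  have hA := R.area_pos
  have hlim : Tendsto (fun r : ℝ => ENNReal.ofReal (((r - d) / r) ^ 2 * (1 / R.area))) atTop
      (𝓝 (ENNReal.ofReal (1 / R.area))) := by
    refine ENNReal.tendsto_ofReal ?_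
    simpa using (tendsto_sub_div_sq d).mul_const (1 / R.area)
  rw [← hlim.liminf_eq, lowerDensity]
  refine liminf_le_liminf ?_
  filter_upwards [eventually_gt_atTop 0, eventually_ge_atTop d] with r hr hrd
  have hv := volume_le_encard_mul (r := r) R.measurableSet hd hP
    (by rw [R.volume_toSet]; simpa using hA)
  rw [R.volume_toSet, volume_disk (sub_nonneg.2 hrd)] at hv
  rw [densityOver, volume_disk hr.le, ENNReal.le_div_iff_mul_le
    (Or.inl (by simp; positivity)) (Or.inl ENNReal.ofReal_ne_top),
    ← ENNReal.ofReal_mul (by positivity)]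
  rw [← ENNReal.div_le_iff_le_mul (Or.inl (by simpa using hA)) (Or.inl ENNReal.ofReal_ne_top),
    ← ENNReal.ofReal_div_of_pos hA] at hv
  refine le_trans (le_of_eq ?_) hv
  congr 1
  field_simp

theorem le_piercingDensity {n : ℕ} (R : Fin n → Rect) (i : Fin n) :
    ENNReal.ofReal (1 / (R i).area) ≤ piercingDensity (family R) :=
  le_iInf₂ fun _ hP => le_lowerDensity (R i) (hP _ ⟨i, rfl⟩)

/-! ### Density of a lattice -/

theorem span_int_eq_latticeSpan (u v : Plane) :
    (Submodule.span ℤ (Set.range ![u, v]) : Set Plane) = latticeSpan u v := by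
  ext p
  rw [Matrix.range_cons_cons_empty, SetLike.mem_coe, Submodule.mem_span_pair]
  simp only [latticeSpan, Set.mem_ofPred_eq, Int.cast_smul_eq_zsmul, eq_comm (a := p)]

theorem linearIndependent_of_det {u v : Plane} (h : u 0 * v 1 - u 1 * v 0 ≠ 0) :
    LinearIndependent ℝ ![u, v] := by
  rw [LinearIndependent.pair_iff]
  intro a b hab
  have h0 : a * u 0 + b * v 0 = 0 := by simpa using congrArg (fun p : Plane => p 0) hab
  have h1 : a * u 1 + b * v 1 = 0 := by simpa using congrArg (fun p : Plane => p 1) hab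
  constructor
  · refine (mul_eq_zero.1 (?_ : a * (u 0 * v 1 - u 1 * v 0) = 0)).resolve_right h
    linear_combination v 1 * h0 - v 0 * h1
  · refine (mul_eq_zero.1 (?_ : b * (u 0 * v 1 - u 1 * v 0) = 0)).resolve_right h
    linear_combination u 0 * h1 - u 1 * h0

theorem covolume_span (b : Module.Basis (Fin 2) ℝ Plane) :
    ZLattice.covolume (Submodule.span ℤ (Set.range b)) = |b 0 0 * b 1 1 - b 0 1 * b 1 0| := by
  have hv : volume.real (ZSpan.fundamentalDomain (EuclideanSpace.basisFun (Fin 2) ℝ).toBasis) = 1 := by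
    rw [measureReal_congr (ZSpan.fundamentalDomain_ae_parallelepiped _ volume), measureReal_def,
      OrthonormalBasis.coe_toBasis, OrthonormalBasis.volume_parallelepiped]
    simp
  rw [ZLattice.covolume_eq_det_mul_measureReal _ _ (b.restrictScalars ℤ)
    (EuclideanSpace.basisFun (Fin 2) ℝ).toBasis, hv, mul_one, Module.Basis.det_apply,
    Matrix.det_fin_two]
  simp [Module.Basis.toMatrix_apply]
  ring_nf

theorem tendsto_densityOver_latticeSpan {u v : Plane} (h : u 0 * v 1 - u 1 * v 0 ≠ 0) :
    Tendsto (fun r : ℝ => densityOver (latticeSpan u v) (disk r)) atTop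
      (𝓝 (ENNReal.ofReal (1 / |u 0 * v 1 - u 1 * v 0|))) := by
  set D := |u 0 * v 1 - u 1 * v 0| with hD
  have hDpos : 0 < D := abs_pos.2 h
  let b := basisOfLinearIndependentOfCardEqFinrank (linearIndependent_of_det h) (by simp)
  have hb : ⇑b = ![u, v] := by simp [b]
  set L := Submodule.span ℤ (Set.range b) with hL
  have hLset : (L : Set Plane) = latticeSpan u v := by rw [hL, hb, span_int_eq_latticeSpan]
  have hcov : ZLattice.covolume L = D := by rw [hL, covolume_span, hb]; rfl
  have hset : ∀ {c r : ℝ}, 0 ≤ r → c = r ^ 2 →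
      {x ∈ (Set.univ : Set Plane) | ‖x‖ ^ 2 ≤ c} = disk r := by
    intro c r hr hc
    ext x
    simp [disk, hc, sq_le_sq₀ (norm_nonneg x) hr]
  -- `‖x‖ ^ 2` is homogeneous of degree 2, the dimension, so the number of lattice points with `‖x‖
  -- ^ 2 ≤ c`, divided by `c`, tends to `π / D`. Then `c = r ^ 2`.
  have key := ZLattice.covolume.tendsto_card_le_div' L (X := Set.univ)
    (F := fun x : Plane => ‖x‖ ^ 2) (fun _ _ _ _ => trivial)
    (fun x r hr => by simp [norm_smul, mul_pow])
    (by rw [hset zero_le_one (by norm_num)]; exact Metric.isBounded_closedBall)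
    (by rw [hset zero_le_one (by norm_num)]; exact Metric.isClosed_closedBall.measurableSet)
    (by rw [hset zero_le_one (by norm_num)]; exact (convex_closedBall (0 : Plane) 1).addHaar_frontier volume)
  rw [hset zero_le_one (by norm_num), hcov, measureReal_def, volume_disk zero_le_one,
    ENNReal.toReal_ofReal (by positivity)] at key
  have key2 := ENNReal.tendsto_ofReal ((key.comp (tendsto_pow_atTop two_ne_zero)).div_const Real.pi)
  have e : 1 ^ 2 * Real.pi / D / Real.pi = 1 / D := by field_simp
  rw [e] at key2
  refine key2.congr' ?_
  filter_upwards [eventually_gt_atTop 0] with r hr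
  have hfin : (latticeSpan u v ∩ disk r).Finite := by
    rw [Set.inter_comm, ← hLset]
    exact ZSpan.setFinite_inter b Metric.isBounded_closedBall
  simp only [Function.comp_apply]
  rw [hset hr.le rfl, hLset, densityOver, volume_disk hr.le, ← hfin.cast_ncard_eq, Set.inter_comm,
    div_div, ENNReal.ofReal_div_of_pos (by positivity), Nat.card_coe_set_eq]
  simp

/-! ### The golden-ratio lattice pierces rectangles -/

open scoped goldenRatio in
-- The upper right corner `(X, Y)` is reduced modulo the lattice to a fundamental square, contained
-- in `[0, φ + 1] × [-1, φ]`. There one of the lattice points `(0, 0)`, `(φ, -1)`, `(-1, -φ)`, `(φ -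
-- 1, -1 - φ)` lies in the box.
theorem exists_mem_golden_rect (x y : ℝ) :
    ∃ a b : ℤ, x ≤ a * φ + b ∧ a * φ + b ≤ x + φ ∧ y ≤ -a + b * φ ∧ -a + b * φ ≤ y + φ ^ 2 := by
  have hφ := Real.goldenRatio_sq
  have h1 := Real.one_lt_goldenRatio
  have h2 := Real.goldenRatio_lt_two
  have hpos : 0 < φ ^ 2 + 1 := by positivity
  have main : ∀ X Y p q : ℝ, X = p * φ + q → Y = -p + q * φ → 0 ≤ p → p < 1 → 0 ≤ q → q < 1 →
      ∃ a b : ℤ, 0 ≤ X - (a * φ + b) ∧ X - (a * φ + b) ≤ φ ∧ 0 ≤ Y - (-a + b * φ) ∧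
        Y - (-a + b * φ) ≤ φ ^ 2 := by
    intro X Y p q hX hY hp0 hp1 hq0 hq1
    have hX0 : 0 ≤ X := by rw [hX]; positivity
    have hX1 : X ≤ φ + 1 := by rw [hX]; nlinarith
    have hY0 : -1 ≤ Y := by rw [hY]; nlinarith
    have hY1 : Y ≤ φ := by rw [hY]; nlinarith
    rcases le_or_gt 0 Y with hY2 | hY2
    · rcases le_or_gt X φ with hX2 | hX2
      · exact ⟨0, 0, by push_cast; refine ⟨?_, ?_, ?_, ?_⟩ <;> linarith⟩
      · exact ⟨1, 0, by push_cast; refine ⟨?_, ?_, ?_, ?_⟩ <;> linarith⟩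
    · rcases le_or_gt (X + 1) φ with hX2 | hX2
      · exact ⟨0, -1, by push_cast; refine ⟨?_, ?_, ?_, ?_⟩ <;> linarith⟩
      · rcases le_or_gt φ X with hX3 | hX3
        · exact ⟨1, 0, by push_cast; refine ⟨?_, ?_, ?_, ?_⟩ <;> linarith⟩
        · exact ⟨1, -1, by push_cast; refine ⟨?_, ?_, ?_, ?_⟩ <;> linarith⟩
  set X := x + φ with hX
  set Y := y + φ ^ 2 with hY
  -- `p` and `q` are the coordinates of the corner in the orthogonal basis `(φ, -1)`, `(1, φ)`.
  set p := (φ * X - Y) / (φ ^ 2 + 1) with hp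
  set q := (X + φ * Y) / (φ ^ 2 + 1) with hq
  have ep : X = p * φ + q := by rw [hp, hq]; field_simp; ring
  have eq : Y = -p + q * φ := by rw [hp, hq]; field_simp; ring
  obtain ⟨a, b, ha, hb, hc, hd⟩ := main (Int.fract p * φ + Int.fract q)
    (-Int.fract p + Int.fract q * φ) _ _ rfl rfl (Int.fract_nonneg _) (Int.fract_lt_one _)
    (Int.fract_nonneg _) (Int.fract_lt_one _)
  have fp := Int.self_sub_floor p
  have fq := Int.self_sub_floor q
  rw [← fp, ← fq] at ha hb hc hd
  refine ⟨⌊p⌋ + a, ⌊q⌋ + b, ?_, ?_, ?_, ?_⟩ <;> push_cast <;> linarith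

open scoped goldenRatio in
theorem exists_mem_scaled_golden_rect {A B : ℝ} (hA : 0 < A) (hB : B ≠ 0) (x y : ℝ) :
    ∃ a b : ℤ, x ≤ A * (a * φ + b) ∧ A * (a * φ + b) ≤ x + A * φ ∧
      y ≤ B * (-a + b * φ) ∧ B * (-a + b * φ) ≤ y + |B| * φ ^ 2 := by
  rcases hB.lt_or_gt with hB | hB
  -- A negative `B` swaps top and bottom, so the upper edge is pulled back to the lower one.
  · obtain ⟨a, b, h1, h2, h3, h4⟩ := exists_mem_golden_rect (x / A) ((y + -B * φ ^ 2) / B)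
    refine ⟨a, b, ?_, ?_, ?_, ?_⟩
    · rwa [div_le_iff₀' hA] at h1
    · have := mul_le_mul_of_nonneg_left h2 hA.le
      rwa [mul_add A (x / A), mul_div_cancel₀ _ hA.ne'] at this
    · have := mul_le_mul_of_nonpos_left h4 hB.le
      rw [mul_add B (_ / B), mul_div_cancel₀ _ hB.ne] at this
      linarith
    · have := mul_le_mul_of_nonpos_left h3 hB.le
      rw [mul_div_cancel₀ _ hB.ne] at this
      rwa [abs_of_neg hB]
  · obtain ⟨a, b, h1, h2, h3, h4⟩ := exists_mem_golden_rect (x / A) (y / B)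
    refine ⟨a, b, ?_, ?_, ?_, ?_⟩
    · rwa [div_le_iff₀' hA] at h1
    · have := mul_le_mul_of_nonneg_left h2 hA.le
      rwa [mul_add A (x / A), mul_div_cancel₀ _ hA.ne'] at this
    · rwa [div_le_iff₀' hB] at h3
    · have := mul_le_mul_of_nonneg_left h4 hB.le
      rw [mul_add B (y / B), mul_div_cancel₀ _ hB.ne'] at this
      rwa [abs_of_pos hB]

open scoped goldenRatio in
-- `φ` is a unit of `ℤ[φ]`, so its powers are integral, and conjugation sends `m + n * φ` to `m + n
-- * ψ`, where `φ * ψ = -1`.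
theorem exists_int_combination_zpow (k : ℤ) :
    ∃ m n : ℤ, φ ^ k = m + n * φ ∧ φ * ψ ^ k = m * φ - n := by
  have hm := Real.goldenRatio_mul_goldenConj
  have hs := Real.goldenRatio_add_goldenConj
  have hsq := Real.goldenRatio_sq
  have hφ : φ⁻¹ = φ - 1 := by rw [Real.inv_goldenRatio]; linarith
  have hψ : ψ⁻¹ = -φ := Real.inv_goldenConj
  induction k using Int.induction_on with
  | zero => exact ⟨1, 0, by simp⟩
  | succ k ih =>
    obtain ⟨m, n, h1, h2⟩ := ih
    refine ⟨n, m + n, ?_, ?_⟩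
    · rw [zpow_add_one₀ Real.goldenRatio_ne_zero, h1]
      push_cast
      linear_combination (n : ℝ) * hsq
    · rw [zpow_add_one₀ Real.goldenConj_ne_zero, ← mul_assoc, h2]
      push_cast
      linear_combination (m : ℝ) * hm - (n : ℝ) * hs
  | pred k ih =>
    obtain ⟨m, n, h1, h2⟩ := ih
    refine ⟨n - m, m, ?_, ?_⟩
    · rw [zpow_sub_one₀ Real.goldenRatio_ne_zero, h1, hφ]
      push_cast
      linear_combination (n : ℝ) * hsq
    · rw [zpow_sub_one₀ Real.goldenConj_ne_zero, ← mul_assoc, h2, hψ]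
      push_cast
      linear_combination -(m : ℝ) * hsq

open scoped goldenRatio in
/-- Every translate of a rectangle of width `w` and height `h` with `φ ^ 4 ≤ w * h` contains a
point of the lattice with basis `(1, φ), (φ, -1)`. -/
theorem exists_golden_lattice_point {w h : ℝ} (hw : 0 < w) (hwh : φ ^ 4 ≤ w * h) (x y : ℝ) :
    ∃ m n : ℤ, x ≤ m + n * φ ∧ m + n * φ ≤ x + w ∧ y ≤ m * φ - n ∧ m * φ - n ≤ y + h := by
  have hφ0 := Real.goldenRatio_pos
  -- With `φ ^ k ≤ w < φ ^ (k + 1)`, the image of the `φ × φ ^ 2` box under `diag(φ ^ (k - 1), ψ ^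
  -- (k - 1))` has width `φ ^ k` and height `φ ^ (3 - k) ≤ h`.
  obtain ⟨k, hk1, hk2⟩ := exists_mem_Ico_zpow hw Real.one_lt_goldenRatio
  have hψ : |ψ ^ (k - 1)| = φ ^ (1 - k) := by
    rw [abs_zpow, abs_of_neg Real.goldenConj_neg, ← Real.inv_goldenRatio, inv_zpow, ← zpow_neg,
      neg_sub]
  have hh : φ ^ (1 - k) * φ ^ 2 ≤ h := by
    have hpow : φ ^ (k + 1) * (φ ^ (1 - k) * φ ^ 2) = φ ^ 4 := by
      rw [← mul_assoc, ← zpow_add₀ hφ0.ne']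
      have : k + 1 + (1 - k) = (2 : ℕ) := by push_cast; ring
      rw [this, zpow_natCast]
      ring
    refine le_of_mul_le_mul_left ?_ hw
    calc w * (φ ^ (1 - k) * φ ^ 2) ≤ φ ^ (k + 1) * (φ ^ (1 - k) * φ ^ 2) := by
          gcongr
      _ ≤ w * h := hpow.trans_le hwh
  obtain ⟨a, b, h1, h2, h3, h4⟩ := exists_mem_scaled_golden_rect (zpow_pos hφ0 (k - 1))
    (zpow_ne_zero (k - 1) Real.goldenConj_ne_zero) x y
  obtain ⟨m₁, n₁, e1, e2⟩ := exists_int_combination_zpow (k - 1)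
  obtain ⟨m₂, n₂, e3, e4⟩ := exists_int_combination_zpow k
  have s1 : φ ^ k = φ ^ (k - 1) * φ := by
    rw [← zpow_add_one₀ hφ0.ne', sub_add_cancel]
  have s2 : φ * ψ ^ k = -ψ ^ (k - 1) := by
    have : ψ ^ k = ψ ^ (k - 1) * ψ := by
      rw [← zpow_add_one₀ Real.goldenConj_ne_zero, sub_add_cancel]
    rw [this]
    linear_combination ψ ^ (k - 1) * Real.goldenRatio_mul_goldenConj
  -- The point found in the stretched lattice is a point of the original one.
  have x1 : ((a * m₂ + b * m₁ : ℤ) : ℝ) + (a * n₂ + b * n₁ : ℤ) * φ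
      = φ ^ (k - 1) * (a * φ + b) := by
    push_cast
    linear_combination -(a : ℝ) * e3 - b * e1 + a * s1
  have y1 : ((a * m₂ + b * m₁ : ℤ) : ℝ) * φ - (a * n₂ + b * n₁ : ℤ)
      = ψ ^ (k - 1) * (-a + b * φ) := by
    push_cast
    linear_combination -(a : ℝ) * e4 - b * e2 + a * s2
  refine ⟨a * m₂ + b * m₁, a * n₂ + b * n₁, ?_⟩
  rw [x1, y1]
  rw [hψ] at h4
  rw [← s1] at h2
  exact ⟨h1, by linarith, h3, by linarith⟩

/-! ### The program -/

theorem Runs.trans {prog : Program} {s t : ℕ} {c d e : Config} (h₁ : Runs prog s c d)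
    (h₂ : Runs prog t d e) : Runs prog (s + t) c e := by
  induction h₁ with
  | refl c => simpa using h₂
  | cons h _ ih =>
    rw [Nat.add_right_comm]
    exact .cons h (ih h₂)

/-- The program computes the maximum `M` of the inverse areas of the rectangles, and from it the
density `(1 + 2 / √5) * M` and the scaling factor `√(1 / M) / φ ^ 2`. -/
def goldenProgram : Program :=
  [.iconst 2 1,
   .rconst 10 1,
   .load 5 1,
   .iadd 1 1 2,
   .load 6 1,
   .iadd 1 1 2,
   .rsub 5 6 5,
   .load 6 1,
   .iadd 1 1 2,
   .load 7 1,
   .iadd 1 1 2,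
   .rsub 6 7 6,
   .rmul 5 5 6,
   .rdiv 5 10 5,
   .rjlt 5 8 16,
   -- Register 9 is never written and holds 0, so adding it copies a register.
   .radd 8 5 9,
   .iadd 3 3 2,
   .ijlt 3 0 2,
   .rconst 6 5,
   .rsqrt 6 6,
   .rconst 7 2,
   .rdiv 5 7 6,
   .radd 5 10 5,
   .rmul 4 5 8,
   .radd 6 10 6,
   .rdiv 6 6 7,
   .rdiv 5 10 8,
   .rsqrt 5 5,
   .rmul 7 6 6,
   .rdiv 0 5 7,
   .rmul 1 0 6,
   .radd 2 1 9,
   .rsub 3 9 0,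
   .halt]

theorem inputMem_left {n k : ℕ} (R : Fin n → Rect) (hk : k < n) :
    inputMem R (4 * k) = (R ⟨k, hk⟩).left := by
  have h₁ : 4 * k / 4 = k := by omega
  have h₂ : 4 * k % 4 = 0 := by omega
  simp only [inputMem, h₁, h₂, hk, dite_true]

theorem inputMem_right {n k : ℕ} (R : Fin n → Rect) (hk : k < n) :
    inputMem R (4 * k + 1) = (R ⟨k, hk⟩).right := by
  have h₁ : (4 * k + 1) / 4 = k := by omega
  have h₂ : (4 * k + 1) % 4 = 1 := by omega
  simp only [inputMem, h₁, h₂, hk, dite_true]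

theorem inputMem_bottom {n k : ℕ} (R : Fin n → Rect) (hk : k < n) :
    inputMem R (4 * k + 1 + 1) = (R ⟨k, hk⟩).bottom := by
  have h₁ : (4 * k + 1 + 1) / 4 = k := by omega
  have h₂ : (4 * k + 1 + 1) % 4 = 2 := by omega
  simp only [inputMem, h₁, h₂, hk, dite_true]

theorem inputMem_top {n k : ℕ} (R : Fin n → Rect) (hk : k < n) :
    inputMem R (4 * k + 1 + 1 + 1) = (R ⟨k, hk⟩).top := by
  have h₁ : (4 * k + 1 + 1 + 1) / 4 = k := by omega
  have h₂ : (4 * k + 1 + 1 + 1) % 4 = 3 := by omega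
  simp only [inputMem, h₁, h₂, hk, dite_true]

/-- The state of the machine at instruction `pc` when `k` rectangles have been processed and the
running maximum is `M`. -/
structure LoopState {n : ℕ} (R : Fin n → Rect) (pc k : ℕ) (M : ℝ) (c : Config) : Prop where
  pc_eq : c.pc = pc
  idx_zero : c.idx 0 = n
  idx_one : c.idx 1 = 4 * k
  idx_two : c.idx 2 = 1
  idx_three : c.idx 3 = k
  reg_eight : c.reg 8 = M
  reg_nine : c.reg 9 = 0
  reg_ten : c.reg 10 = 1
  mem_eq : c.mem = inputMem R

theorem runs_init {n : ℕ} (R : Fin n → Rect) :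
    ∃ c, Runs goldenProgram 2 (initConfig R) c ∧ LoopState R 2 0 0 c := by
  refine ⟨_, .cons rfl (.cons rfl (.refl _)), ?_⟩
  constructor <;> simp [initConfig, Config.setIdx, Config.setReg]

theorem runs_inv_area {n : ℕ} {R : Fin n → Rect} {k : ℕ} (hk : k < n) {M : ℝ} {c : Config}
    (hc : LoopState R 2 k M c) :
    ∃ d, Runs goldenProgram 12 c d ∧ d.pc = 14 ∧ d.idx 0 = n ∧ d.idx 1 = 4 * (k + 1) ∧
      d.idx 2 = 1 ∧ d.idx 3 = k ∧ d.reg 5 = 1 / (R ⟨k, hk⟩).area ∧ d.reg 8 = M ∧ d.reg 9 = 0 ∧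
      d.reg 10 = 1 ∧ d.mem = inputMem R := by
  obtain ⟨pc, idx, reg, mem⟩ := c
  obtain ⟨rfl, h0, h1, h2, h3, h8, h9, h10, rfl⟩ := hc
  dsimp only at h0 h1 h2 h3 h8 h9 h10
  have hA := (R ⟨k, hk⟩).area_pos
  refine ⟨_, .cons rfl (.cons rfl (.cons rfl (.cons rfl (.cons rfl (.cons rfl (.cons rfl
    (.cons rfl (.cons rfl (.cons rfl (.cons rfl (.cons (if_neg ?_) (.refl _)))))))))))), ?_⟩
  · simp [Config.setIdx, Config.setReg, h1, h2, inputMem_left R hk,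
      inputMem_right R hk, inputMem_bottom R hk, inputMem_top R hk]
    exact ⟨(sub_pos.2 (R ⟨k, hk⟩).left_lt_right).ne', (sub_pos.2 (R ⟨k, hk⟩).bottom_lt_top).ne'⟩
  · simp [Config.setIdx, Config.setReg, h0, h1, h2, h3, h8, h9, h10,
      inputMem_left R hk, inputMem_right R hk, inputMem_bottom R hk, inputMem_top R hk, Rect.area]
    ring

theorem runs_loop {n : ℕ} {R : Fin n → Rect} {k : ℕ} (hk : k < n) {M : ℝ} {c : Config}
    (hc : LoopState R 2 k M c) :
    ∃ t ≤ 16, ∃ d, Runs goldenProgram t c d ∧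
      LoopState R (if k + 1 < n then 2 else 18) (k + 1) (max M (1 / (R ⟨k, hk⟩).area)) d := by
  obtain ⟨⟨pc, idx, reg, mem⟩, hr, rfl, h0, h1, h2, h3, h5, h8, h9, h10, rfl⟩ :=
    runs_inv_area hk hc
  dsimp only at h0 h1 h2 h3 h5 h8 h9 h10
  by_cases h : reg 5 < reg 8
  · have e : step goldenProgram ⟨14, idx, reg, inputMem R⟩ = some ⟨16, idx, reg, inputMem R⟩ := by
      have : step goldenProgram ⟨14, idx, reg, inputMem R⟩ =
        some ⟨if reg 5 < reg 8 then 16 else 15, idx, reg, inputMem R⟩ := rfl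
      rw [this, if_pos h]
    refine ⟨12 + 3, by norm_num, _, hr.trans (.cons e (.cons rfl (.cons rfl (.refl _)))), ?_⟩
    rw [h5, h8] at h
    constructor <;> simp [Config.setIdx, h0, h1, h2, h3, h8, h9, h10]
    simpa using h.le
  · have e : step goldenProgram ⟨14, idx, reg, inputMem R⟩ = some ⟨15, idx, reg, inputMem R⟩ := by
      have : step goldenProgram ⟨14, idx, reg, inputMem R⟩ =
        some ⟨if reg 5 < reg 8 then 16 else 15, idx, reg, inputMem R⟩ := rfl
      rw [this, if_neg h]
    refine ⟨12 + 4, le_rfl, _,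
      hr.trans (.cons e (.cons rfl (.cons rfl (.cons rfl (.refl _))))), ?_⟩
    rw [h5, h8, not_lt] at h
    constructor <;>
      simp [Config.setIdx, Config.setReg, h0, h1, h2, h3, h5, h9, h10]
    simpa using h

/-- After `k` rounds the running maximum is the greatest inverse area of the first `k`
rectangles. -/
theorem runs_loop_iterate {n : ℕ} (R : Fin n → Rect) (k : ℕ) (hk : k < n) :
    ∃ t ≤ 2 + 16 * (k + 1), ∃ c M, Runs goldenProgram t (initConfig R) c ∧
      LoopState R (if k + 1 < n then 2 else 18) (k + 1) M c ∧
      (∃ i, M = 1 / (R i).area) ∧ ∀ i : Fin n, (i : ℕ) ≤ k → 1 / (R i).area ≤ M := by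
  induction k with
  | zero =>
    obtain ⟨c, hr, hc⟩ := runs_init R
    obtain ⟨t, ht, d, hr', hd⟩ := runs_loop hk hc
    -- The initial value 0 is below every inverse area, so from the first round on the maximum is
    -- attained by a rectangle.
    rw [max_eq_right (one_div_pos.2 (R ⟨0, hk⟩).area_pos).le] at hd
    refine ⟨2 + t, by omega, d, _, hr.trans hr', hd, ⟨_, rfl⟩, fun i hi => ?_⟩
    have : i = ⟨0, hk⟩ := Fin.ext (by simpa using hi)
    rw [this]
  | succ k ih =>
    obtain ⟨t, ht, c, M, hr, hc, ⟨i, hi⟩, hM⟩ := ih (Nat.lt_of_succ_lt hk)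
    rw [if_pos hk] at hc
    obtain ⟨t', ht', d, hr', hd⟩ := runs_loop hk hc
    refine ⟨t + t', by omega, d, _, hr.trans hr', hd, ?_, fun j hj => ?_⟩
    · rcases max_choice M (1 / (R ⟨k + 1, hk⟩).area) with h | h
      · exact ⟨i, h.trans hi⟩
      · exact ⟨_, h⟩
    · rcases Nat.le_succ_iff.1 hj with h | h
      · exact (hM j h).trans (le_max_left _ _)
      · have : j = ⟨k + 1, hk⟩ := Fin.ext h
        rw [this]
        exact le_max_right _ _

open scoped goldenRatio in
theorem runs_output {n : ℕ} {R : Fin n → Rect} {k : ℕ} {M : ℝ} (hM : 0 < M) {c : Config}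
    (hc : LoopState R 18 k M c) :
    ∃ d, HaltsIn goldenProgram 15 c d ∧
      d.outU = (√(1 / M) / φ ^ 2) • (!₂[1, φ] : Plane) ∧
      d.outV = (√(1 / M) / φ ^ 2) • (!₂[φ, -1] : Plane) ∧
      d.outValue = (1 + 2 / √5) * M := by
  obtain ⟨pc, idx, reg, mem⟩ := c
  obtain ⟨rfl, -, -, -, -, h8, h9, h10, -⟩ := hc
  dsimp only at h8 h9 h10
  have h5 : (0 : ℝ) < √5 := by positivity
  have hφ : (1 + √5) / 2 = φ := rfl
  have hφ₀ : 1 + √5 ≠ 0 := by positivity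
  have hsq : φ * φ = φ + 1 := by rw [← pow_two, Real.goldenRatio_sq]
  -- The six `if_neg` goals exclude the possible faults: square roots of 5 and `1 / M`, divisions by
  -- `√5`, 2, `M` and `φ * φ`.
  refine ⟨_, ⟨.cons rfl (.cons (if_neg ?_) (.cons rfl (.cons (if_neg ?_) (.cons rfl (.cons rfl
    (.cons rfl (.cons (if_neg ?_) (.cons (if_neg ?_) (.cons (if_neg ?_) (.cons rfl
    (.cons (if_neg ?_) (.cons rfl (.cons rfl (.cons rfl (.refl _))))))))))))))), rfl⟩, ?_⟩
  · simp [Config.setReg]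
  · simp [Config.setReg]
  · simp [Config.setReg]
  · simp [Config.setReg, h8, hM.ne']
  · simp [Config.setReg, h8, h10, hM.le]
  · simp [Config.setReg, h10, hφ₀]
  · simp [Config.outU, Config.outV, Config.outValue, Config.setReg, h8, h9,
      h10, hφ]
    constructor <;> (ext i; fin_cases i <;> simp [hsq])

/-! ### The scaled lattice, its density, and the running time -/

open scoped goldenRatio in
theorem isPiercing_golden_lattice {n : ℕ} {R : Fin n → Rect} {s : ℝ} (hs : 0 < s)
    (hR : ∀ i, φ ^ 4 * s ^ 2 ≤ (R i).area) :
    IsPiercing (family R)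
      (latticeSpan (s • (!₂[1, φ] : Plane)) (s • (!₂[φ, -1] : Plane))) := by
  rintro _ ⟨i, rfl⟩ x
  have hw : 0 < ((R i).right - (R i).left) / s := div_pos (sub_pos.2 (R i).left_lt_right) hs
  have hwh : φ ^ 4 ≤ ((R i).right - (R i).left) / s * (((R i).top - (R i).bottom) / s) := by
    rw [div_mul_div_comm, ← pow_two, le_div_iff₀ (by positivity)]
    exact hR i
  obtain ⟨a, b, h1, h2, h3, h4⟩ := exists_golden_lattice_point hw hwh
    ((x 0 + (R i).left) / s) ((x 1 + (R i).bottom) / s)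
  rw [← add_div, le_div_iff₀' hs] at h2 h4
  rw [div_le_iff₀' hs] at h1 h3
  refine ⟨_, ⟨a, b, rfl⟩, mem_translate.2 ?_⟩
  simp only [Rect.toSet, Set.mem_ofPred_eq, PiLp.sub_apply, PiLp.add_apply, PiLp.smul_apply,
    smul_eq_mul, Matrix.cons_val_zero, Matrix.cons_val_one]
  refine ⟨?_, ?_, ?_, ?_⟩ <;> linarith

theorem approximation_factor_lt : (1 + 2 / 5 * √5 : ℝ) < 1.895 := by
  have : √5 < 2.2375 := by
    rw [Real.sqrt_lt' (by norm_num)]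
    norm_num
  linarith

open scoped goldenRatio in
theorem one_div_abs_det_golden {M : ℝ} (hM : 0 < M) {s : ℝ} (hs : s ^ 2 * φ ^ 4 = 1 / M) :
    1 / |s * 1 * (s * -1) - s * φ * (s * φ)| = (1 + 2 / 5 * √5) * M := by
  have hφ := Real.goldenRatio_sq
  have h5 : √5 = 2 * φ - 1 := by rw [Real.goldenRatio]; ring
  have hφ0 := Real.goldenRatio_pos
  have h4 : φ ^ 4 = 3 * φ + 2 := by linear_combination (φ ^ 2 + φ + 2) * hφ
  have hs2 : s ^ 2 = 1 / (M * (3 * φ + 2)) := by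
    rw [h4] at hs
    field_simp
    field_simp at hs
    linarith
  have hdet : s * 1 * (s * -1) - s * φ * (s * φ) = -(s ^ 2 * (φ + 2)) := by
    linear_combination -(s ^ 2) * hφ
  rw [hdet, abs_neg, abs_of_nonneg (by positivity), hs2, h5]
  field_simp
  linear_combination -8 * hφ

theorem exists_program_output {n : ℕ} (hn : 0 < n) (R : Fin n → Rect) :
    ∃ t ≤ 33 * n, ∃ c M, HaltsIn goldenProgram t (initConfig R) c ∧
      c.outU = (√(1 / M) / Real.goldenRatio ^ 2) • (!₂[1, Real.goldenRatio] : Plane) ∧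
      c.outV = (√(1 / M) / Real.goldenRatio ^ 2) • (!₂[Real.goldenRatio, -1] : Plane) ∧
      c.outValue = (1 + 2 / 5 * √5) * M ∧
      (∃ i, M = 1 / (R i).area) ∧ ∀ i, 1 / (R i).area ≤ M := by
  obtain ⟨t, ht, c, M, hr, hc, ⟨i, hi⟩, hM⟩ := runs_loop_iterate R (n - 1) (by omega)
  rw [if_neg (by omega)] at hc
  have hM0 : 0 < M := hi ▸ one_div_pos.2 (R i).area_pos
  obtain ⟨d, ⟨hr', hh⟩, hu, hv, ha⟩ := runs_output hM0 hc
  -- Setup 2, at most 16 per rectangle, output 15: `16 * n + 17 ≤ 33 * n` as `n ≥ 1`.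
  refine ⟨t + 15, by omega, d, M, ⟨hr.trans hr', hh⟩, hu, hv, ?_, ⟨i, hi⟩,
    fun j => hM j (by omega)⟩
  rw [ha]
  have h5 : √5 ^ 2 = (5 : ℝ) := Real.sq_sqrt (by norm_num)
  have h5' : √5 ≠ (0 : ℝ) := by positivity
  congr 2
  field_simp
  linarith

end Piercing

theorem theorem3 :
    (1 + 2 / 5 * Real.sqrt 5 : ℝ) < 1.895 ∧
    ∃ (prog : Piercing.Program) (C : ℕ),
      ∀ (n : ℕ) (_ : 0 < n) (R : Fin n → Piercing.Rect),
        ∃ (t : ℕ) (c : Piercing.Config),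
          -- on input `R` the program stops after at most `C * n` steps
          t ≤ C * n ∧
          Piercing.HaltsIn prog t (Piercing.initConfig R) c ∧
          -- the output vectors are a basis of a rescaled golden-ratio lattice
          LinearIndependent ℝ ![c.outU, c.outV] ∧
          (∃ s : ℝ, 0 < s ∧
            c.outU = s • (!₂[1, Real.goldenRatio] : Piercing.Plane) ∧
            c.outV = s • (!₂[Real.goldenRatio, -1] : Piercing.Plane)) ∧
          -- this lattice pierces all translates of all the rectangles
          Piercing.IsPiercing (Piercing.family R) (Piercing.latticeSpan c.outU c.outV) ∧
          -- the output number is the density of the lattice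
          0 < c.outValue ∧
          Piercing.lowerDensity (Piercing.latticeSpan c.outU c.outV) =
            ENNReal.ofReal c.outValue ∧
          Piercing.upperDensity (Piercing.latticeSpan c.outU c.outV) =
            ENNReal.ofReal c.outValue ∧
          -- the density of the lattice is at most `1 + (2/5)√5` times the piercing density
          Piercing.upperDensity (Piercing.latticeSpan c.outU c.outV) ≤
            ENNReal.ofReal (1 + 2 / 5 * Real.sqrt 5) *
              Piercing.piercingDensity (Piercing.family R) ∧
          -- the output number is a 1.895-approximation of the piercing density
          Piercing.piercingDensity (Piercing.family R) ≤ ENNReal.ofReal c.outValue ∧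
          ENNReal.ofReal c.outValue ≤
            ENNReal.ofReal 1.895 * Piercing.piercingDensity (Piercing.family R) := by

  refine ⟨Piercing.approximation_factor_lt, Piercing.goldenProgram, 33, fun n hn R => ?_⟩
  obtain ⟨t, ht, c, M, hc, hu, hv, ha, ⟨i, hi⟩, hM⟩ := Piercing.exists_program_output hn R
  have hM0 : 0 < M := hi ▸ one_div_pos.2 (R i).area_pos
  set s := √(1 / M) / Real.goldenRatio ^ 2 with hs
  have hs0 : 0 < s := div_pos (Real.sqrt_pos.2 (one_div_pos.2 hM0))
    (pow_pos Real.goldenRatio_pos 2)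
  have hs2 : s ^ 2 * Real.goldenRatio ^ 4 = 1 / M := by
    rw [hs, div_pow, Real.sq_sqrt (one_div_pos.2 hM0).le, ← pow_mul,
      div_mul_cancel₀ _ (pow_ne_zero _ Real.goldenRatio_ne_zero)]
  have hdet : 1 / |c.outU 0 * c.outV 1 - c.outU 1 * c.outV 0| = c.outValue := by
    rw [ha, ← Piercing.one_div_abs_det_golden hM0 hs2, hu, hv]
    rfl
  have ha0 : 0 < c.outValue := by rw [ha]; positivity
  have hdet0 : c.outU 0 * c.outV 1 - c.outU 1 * c.outV 0 ≠ 0 := by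
    intro h
    rw [h] at hdet
    simp at hdet
    linarith
  have hpierce : Piercing.IsPiercing (Piercing.family R)
      (Piercing.latticeSpan c.outU c.outV) := by
    rw [hu, hv]
    refine Piercing.isPiercing_golden_lattice hs0 fun j => ?_
    rw [mul_comm, hs2]
    exact (one_div_le (R j).area_pos hM0).1 (hM j)
  have hlim := Piercing.tendsto_densityOver_latticeSpan hdet0
  rw [hdet] at hlim
  have hlow : Piercing.lowerDensity (Piercing.latticeSpan c.outU c.outV) =
      ENNReal.ofReal c.outValue := hlim.liminf_eq
  have hupp : Piercing.upperDensity (Piercing.latticeSpan c.outU c.outV) =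
      ENNReal.ofReal c.outValue := hlim.limsup_eq
  have hbound : ENNReal.ofReal c.outValue ≤ ENNReal.ofReal (1 + 2 / 5 * Real.sqrt 5) *
      Piercing.piercingDensity (Piercing.family R) := by
    rw [ha, ENNReal.ofReal_mul (by positivity), hi]
    gcongr
    exact Piercing.le_piercingDensity R i
  refine ⟨t, c, ht, hc, Piercing.linearIndependent_of_det hdet0, ⟨s, hs0, hu, hv⟩, hpierce, ha0,
    hlow, hupp, hupp ▸ hbound, hlow ▸ iInf₂_le _ hpierce, hbound.trans ?_⟩
  gcongr
  exact Piercing.approximation_factor_lt.le
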